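/- **Models.** A restricted Boltzmann machine (RBM) with $N$ visible and $m$ hidden units is the law on $\{\pm1\}^N\times\{\pm1\}^m$ given by $$\Pr[X=x,H=h]\propto\exp\big(\langle x,Wh\rangle+\langle b^{(1)},x\rangle+\langle b^{(2)},h\rangle\big),$$ with $W\in\mathbb R^{N\times m}$, $b^{(1)}\in\mathbb R^N$, $b^{(2)}\in\mathbb R^m$; only $X$ is observed. It is $(\lambda_1,\lambda_2)$-bounded if $\sum_j|\tanh W_{ij}|+|b^{(1)}_i|\le\lambda_1$ for all $i$ and $\sum_i|W_{ij}|\le\lambda_2$ for all $j$. The Markov blanket of a visible unit $i$ is the minimal set $S$ of other visible units such that $X_i$ is conditionally independent of all remaining visible units given $X_S$; its elements are the neighbors of $i$. Neighbors $i,j$ are $\eta$-nondegenerate if the conditional mutual information (in nats) satisfies $I(X_i;X_j\mid X_{\sim i,j})\ge\eta$. Structure recovery means outputting, with probability at least $0.995$, the Markov blankets of all visible units (as an adjacency matrix), given sample access to $X$. **Algorithms.** An algorithm is a probabilistic multitape Turing machine with an oracle that supplies, in one step, a fresh i.i.d. sample on a sample tape, which is then read bit by bit. It is told $n$ and $k$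 in unary. It has runtime $T$ on a sample law if it halts within $T$ steps with probability one. There is no other limit on the number of samples. **Hardness assumption.** Fix a constant $\beta\in(0,1/2)$. For $S\subseteq\{1,\dots,n\}$ with $|S|=k$, the $k$-sparse parity with noise is the law of $(X,Y)\in\{\pm1\}^{n+1}$ where $X$ is uniform on $\{\pm1\}^n$, and $Y=\prod_{s\in S}X_s$ with probability $1/2+\beta$ and $Y=-\prod_{s\in S}X_s$ with probability $1/2-\beta$. An algorithm solves the testing problem at $(n,k)$ in time $T$ if it has runtime $T$ on the uniform law on $\{\pm1\}^{n+1}$ and on all these laws, and, for every such $S$, distinguishes the two with sum of the Type I and Type II error probabilities at most $0.01$. Call a sequence $(k_n)$ of positive integers admissible if $k_n=o(n^{1-\varepsilon})$ for some $\varepsilon>0$. Assume: for every admissible $(k_n)$ and every algorithm that solves the testing problem at $(n,k_n)$ in time $T(n)$ for all large $n$, one has $T(n)\ge n^{\Omega(k_n)}$. **Theorem.** Under this assumption there are a constant $\eta>0$, numbers $\lambda_1(k)$ ($k\ge1$) with $\lambda_1(k)/\eta>e$ and $$\frac{\log(\lambda_1(k)/\eta)}{\log\log(\lambda_1(k)/\eta)}=\Omega(k),$$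 and classes $\mathcal F_{n,k}$ of RBMs with $n+1$ visible units, all of them $(\lambda_1(k),2)$-bounded and with all neighbors $\eta$-nondegenerate, such that the following holds. For every admissible $(k_n)$, with $\lambda_1=\lambda_1(k_n)$, every algorithm that (given $n$ and $k_n$) achieves structure recovery for every RBM in $\mathcal F_{n,k_n}$ in time $T(n)$, for all large $n$, satisfies $$T(n)\ge n^{\Omega\left(\frac{\log(\lambda_1/\eta)}{\log\log(\lambda_1/\eta)}\right)}$$ regardless of its sample complexity. Here $T(n)\ge n^{\Omega(g(n))}$ means that there is $c>0$ (which may depend on the algorithm, on $T$ and on the sequence) with $T(n)\ge n^{c\,g(n)}$ for all sufficiently large $n$. -/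

import Mathlib

open Filter

noncomputable section

/-! ### Restricted Boltzmann machines -/

/-- The spin of a bit: `true` is `+1` and `false` is `-1`. -/
def spin (b : Bool) : ℤ := if b then 1 else -1

/-- The parameters of a restricted Boltzmann machine with `N` visible and `m` hidden units. -/
structure RBM (N m : ℕ) where
  /-- The weight matrix: rows are visible units, columns are hidden units. -/
  weight : Matrix (Fin N) (Fin m) ℝ
  /-- The external field on the visible units. -/
  visBias : Fin N → ℝ
  /-- The external field on the hidden units. -/
  hidBias : Fin m → ℝ

namespace RBM

variable {N m : ℕ}

/-- The exponent `⟨x, W h⟩ + ⟨b¹, x⟩ + ⟨b², h⟩`. -/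
def potential (R : RBM N m) (x : Fin N → Bool) (h : Fin m → Bool) : ℝ :=
  (∑ i, ∑ j, (spin (x i) : ℝ) * R.weight i j * (spin (h j) : ℝ))
    + (∑ i, R.visBias i * (spin (x i) : ℝ)) + ∑ j, R.hidBias j * (spin (h j) : ℝ)

/-- The joint law of the visible and hidden units: `Pr[X = x, H = h] ∝ exp (potential x h)`. -/
def jointLaw (R : RBM N m) : PMF ((Fin N → Bool) × (Fin m → Bool)) :=
  PMF.normalize (fun z => ENNReal.ofReal (Real.exp (R.potential z.1 z.2)))
    (by
      rw [tsum_fintype]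
      intro h0
      have h1 := (Finset.sum_eq_zero_iff.mp h0) default (Finset.mem_univ _)
      exact absurd (ENNReal.ofReal_eq_zero.mp h1) (not_le.mpr (Real.exp_pos _)))
    (by
      rw [tsum_fintype]
      exact ENNReal.sum_ne_top.mpr fun _ _ => ENNReal.ofReal_ne_top)

/-- The law of the observed vector `X`. -/
def visibleLaw (R : RBM N m) : PMF (Fin N → Bool) := R.jointLaw.map Prod.fst

/-- `(lam1, lam2)`-boundedness. -/
def IsBounded (R : RBM N m) (lam1 lam2 : ℝ) : Prop :=
  (∀ i, ∑ j, |Real.tanh (R.weight i j)| + |R.visBias i| ≤ lam1) ∧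
    ∀ j, ∑ i, |R.weight i j| ≤ lam2

end RBM

/-! ### Markov blankets and conditional mutual information -/

section Structure

variable {N : ℕ}

/-- `Pr[X_a = x_a for all a ∈ A]`. -/
def marginal (P : PMF (Fin N → Bool)) (A : Finset (Fin N)) (x : Fin N → Bool) : ℝ :=
  ∑ y : Fin N → Bool with (∀ a ∈ A, y a = x a), (P y).toReal

/-- For `i ∉ S`: the coordinate `X_i` is conditionally independent, given `X_S`, of all remaining
coordinates, written without division. -/
def Separates (P : PMF (Fin N → Bool)) (i : Fin N) (S : Finset (Fin N)) : Prop :=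
  ∀ x : Fin N → Bool,
    marginal P Finset.univ x * marginal P S x
      = marginal P (insert i S) x * marginal P (Finset.univ.erase i) x

/-- `S` is a Markov blanket of `i`: an inclusion-minimal set of other coordinates such that `X_i` is
conditionally independent of all the others given `X_S`. -/
def IsMarkovBlanket (P : PMF (Fin N → Bool)) (i : Fin N) (S : Finset (Fin N)) : Prop :=
  Minimal (fun A => i ∉ A ∧ Separates P i A) S

/-- `j` is a (two-hop) neighbor of `i`: it lies in the Markov blanket of `i`. -/
def IsNeighbor (P : PMF (Fin N → Bool)) (i j : Fin N) : Prop :=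
  ∃ S, IsMarkovBlanket P i S ∧ j ∈ S

/-- The conditional mutual information `I(X_i; X_j | X_{∼i,j})` in nats, for `i ≠ j`. -/
def condMutualInfo (P : PMF (Fin N → Bool)) (i j : Fin N) : ℝ :=
  ∑ x : Fin N → Bool, (P x).toReal *
    Real.log ((P x).toReal * marginal P ((Finset.univ.erase i).erase j) x
      / (marginal P (Finset.univ.erase j) x * marginal P (Finset.univ.erase i) x))

/-- All neighbors are `eta`-nondegenerate. -/
def AllNondegenerate (P : PMF (Fin N → Bool)) (eta : ℝ) : Prop :=
  ∀ i j, IsNeighbor P i j → eta ≤ condMutualInfo P i j ∨ eta ≤ condMutualInfo P j i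

end Structure

/-! ### Randomized algorithms with a sample oracle -/

/-- What a machine does in one step. A head instruction `none` leaves the head where it is. -/
structure SampleAction (State Symbol : Type) (tapes : ℕ) where
  /-- The next state; `none` halts. -/
  next : Option State
  /-- The symbol written on each work tape, before the head moves. -/
  write : Fin tapes → Symbol
  /-- The head movement on each work tape. -/
  move : Fin tapes → Option Turing.Dir
  /-- The head movement on the read-only input tape. -/
  inputMove : Option Turing.Dir
  /-- The head movement on the read-only sample tape (ignored when a sample is requested). -/
  sampleMove : Option Turing.Dir
  /-- Whether to request a new sample, which replaces the contents of the sample tape. -/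
  request : Bool
  /-- The bit appended to the output, if any. -/
  emit : Option Bool

/-- A probabilistic multitape Turing machine with access to a sample oracle. In each step it sees its
state, a fresh fair coin, the scanned symbols of the input tape and of the sample tape (both over
`0`, `1`, blank) and the scanned symbols of its work tapes. -/
structure SampleTM where
  State : Type
  Symbol : Type
  tapes : ℕ
  finState : Finite State
  finSymbol : Finite Symbol
  blank : Inhabited Symbol
  start : State
  step : State → Bool → Option Bool → Option Bool → (Fin tapes → Symbol) →
    SampleAction State Symbol tapes

attribute [instance] SampleTM.finState SampleTM.finSymbol SampleTM.blank

/-- Move a head, or leave it in place. -/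
def moveHead {A : Type} [Inhabited A] (d : Option Turing.Dir) (t : Turing.Tape A) : Turing.Tape A :=
  match d with
  | none => t
  | some d => t.move d

namespace SampleTM

/-- A configuration; the state `none` is the halted state. -/
structure Cfg (M : SampleTM) where
  state : Option M.State
  input : Turing.Tape (Option Bool)
  sample : Turing.Tape (Option Bool)
  work : Fin M.tapes → Turing.Tape M.Symbol
  output : List Bool

/-- The initial configuration: all tapes other than the input tape are blank. -/
def init (M : SampleTM) (w : List Bool) : M.Cfg where
  state := some M.start
  input := Turing.Tape.mk₁ (w.map some)
  sample := Turing.Tape.mk₁ []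
  work := fun _ => Turing.Tape.mk₁ []
  output := []

/-- The configuration after an action, given the contents of the sample tape. -/
def Cfg.apply {M : SampleTM} (c : M.Cfg) (a : SampleAction M.State M.Symbol M.tapes)
    (sampleTape : Turing.Tape (Option Bool)) : M.Cfg where
  state := a.next
  input := moveHead a.inputMove c.input
  sample := sampleTape
  work := fun t => moveHead (a.move t) ((c.work t).write (a.write t))
  output := c.output ++ a.emit.toList

/-- One step with sample law `D`: every coin and every requested sample is drawn afresh, and the head
of the sample tape is put on the first bit of a new sample. A halted configuration does not change. -/
def stepLaw {N : ℕ} (M : SampleTM) (D : PMF (Fin N → Bool)) (c : M.Cfg) : PMF M.Cfg :=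
  match c.state with
  | none => PMF.pure c
  | some q =>
    (PMF.uniformOfFintype Bool).bind fun coin =>
      let a := M.step q coin c.input.head c.sample.head (fun t => (c.work t).head)
      if a.request then
        D.map fun x => c.apply a (Turing.Tape.mk₁ ((List.ofFn x).map some))
      else
        PMF.pure (c.apply a (moveHead a.sampleMove c.sample))

/-- The law of the configuration after `t` steps on input `w`. -/
def run {N : ℕ} (M : SampleTM) (D : PMF (Fin N → Bool)) (w : List Bool) : ℕ → PMF M.Cfg
  | 0 => PMF.pure (M.init w)
  | t + 1 => (M.run D w t).bind (M.stepLaw D)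

/-- With probability one, the machine halts within `t` steps. -/
def HaltsWithin {N : ℕ} (M : SampleTM) (D : PMF (Fin N → Bool)) (w : List Bool) (t : ℕ) : Prop :=
  ∀ c ∈ (M.run D w t).support, c.state = none

/-- The probability that the output after `t` steps lies in `E`. -/
def outputProb {N : ℕ} (M : SampleTM) (D : PMF (Fin N → Bool)) (w : List Bool) (t : ℕ)
    (E : Set (List Bool)) : ℝ :=
  ((M.run D w t).toOuterMeasure {c | c.output ∈ E}).toReal

end SampleTM

/-- The input that tells an algorithm the numbers `n` and `k`, in unary. -/
def instanceInput (n k : ℕ) : List Bool :=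
  List.replicate n true ++ false :: List.replicate k true

/-! ### Sparse parity with noise -/

/-- A bit that is `true` with probability `1/2 + beta`. -/
def biasedBit (beta : Set.Ioo (0 : ℝ) (1 / 2)) : PMF Bool :=
  PMF.ofFintype
    (fun b => if b then ENNReal.ofReal (1 / 2 + beta.1) else ENNReal.ofReal (1 / 2 - beta.1))
    (by
      have h := beta.2
      rw [Fintype.sum_bool]
      simp only [if_true, Bool.false_eq_true, if_false]
      rw [← ENNReal.ofReal_add (by linarith [h.1]) (by linarith [h.2])]
      norm_num)

/-- The bit whose spin is `∏ s ∈ S, x_s`. -/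
def parityBit {n : ℕ} (S : Finset (Fin n)) (x : Fin n → Bool) : Bool :=
  decide (∏ s ∈ S, spin (x s) = 1)

/-- The law of `(X, Y)` for parity with noise on `S`: `X` is uniform, and `Y` is the parity of `X` on
`S` with probability `1/2 + beta` and its negative otherwise. The last coordinate is `Y`. -/
def parityLaw {n : ℕ} (beta : Set.Ioo (0 : ℝ) (1 / 2)) (S : Finset (Fin n)) :
    PMF (Fin (n + 1) → Bool) :=
  (PMF.uniformOfFintype (Fin n → Bool)).bind fun x =>
    (biasedBit beta).map fun agree =>
      Fin.snoc (α := fun _ => Bool) x (if agree then parityBit S x else !parityBit S x)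

/-- Given `n` and `k`, the machine halts within `t` steps on the uniform law and on every `k`-sparse
parity with noise, and tests between the two (output `0` for uniform, `1` for parity) with sum of the
probabilities of the errors of both types at most `0.01`. -/
def SampleTM.SolvesSparseParity (M : SampleTM) (beta : Set.Ioo (0 : ℝ) (1 / 2)) (n k t : ℕ) :
    Prop :=
  M.HaltsWithin (PMF.uniformOfFintype (Fin (n + 1) → Bool)) (instanceInput n k) t ∧
    ∀ S : Finset (Fin n), S.card = k →
      M.HaltsWithin (parityLaw beta S) (instanceInput n k) t ∧
        M.outputProb (PMF.uniformOfFintype (Fin (n + 1) → Bool)) (instanceInput n k) t {[false]}ᶜ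
          + M.outputProb (parityLaw beta S) (instanceInput n k) t {[true]}ᶜ ≤ 1 / 100

/-- Sequences of positive integers that are `o(n^(1 - ε))` for some `ε > 0`. -/
def IsSparsitySequence (k : ℕ → ℕ) : Prop :=
  (∀ n, 0 < k n) ∧
    ∃ ε : ℝ, 0 < ε ∧ (fun n => (k n : ℝ)) =o[atTop] fun n : ℕ => (n : ℝ) ^ (1 - ε)

/-- Hardness of sparse parity with noise: for every sparsity sequence `k`, an algorithm that solves
the `k n`-sparse testing problem for all large `n` has runtime `n ^ Ω(k n)`. -/
def SparseParityHard (beta : Set.Ioo (0 : ℝ) (1 / 2)) : Prop :=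
  ∀ k : ℕ → ℕ, IsSparsitySequence k →
    ∀ (M : SampleTM) (T : ℕ → ℕ), (∀ᶠ n in atTop, M.SolvesSparseParity beta n (k n) (T n)) →
      ∃ c : ℝ, 0 < c ∧ ∀ᶠ n : ℕ in atTop, (n : ℝ) ^ (c * (k n : ℝ)) ≤ (T n : ℝ)

/-! ### Structure recovery -/

/-- The adjacency matrix of a neighborhood system, row by row, as a list of bits. -/
def encodeNeighborhoods {N : ℕ} (nb : Fin N → Finset (Fin N)) : List Bool :=
  (List.finRange N).flatMap fun i => (List.finRange N).map fun j => decide (j ∈ nb i)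

/-- The outputs that correctly list the Markov blankets of all coordinates. -/
def correctStructures {N : ℕ} (P : PMF (Fin N → Bool)) : Set (List Bool) :=
  {w | ∃ nb : Fin N → Finset (Fin N), w = encodeNeighborhoods nb ∧
    ∀ i, IsMarkovBlanket P i (nb i)}

/-- Given `n` and `k` and sample access to the visible units of an RBM in the class `F`, the machine
halts within `t` steps and outputs the structure of the RBM with probability at least `0.995`. -/
def SampleTM.RecoversStructure (M : SampleTM) {N : ℕ} (F : Set (Σ m : ℕ, RBM N m))
    (n k t : ℕ) : Prop :=
  ∀ R ∈ F, M.HaltsWithin R.2.visibleLaw (instanceInput n k) t ∧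
    199 / 200 ≤ M.outputProb R.2.visibleLaw (instanceInput n k) t
      (correctStructures R.2.visibleLaw)

/-- The exponent `log r / log log r`. -/
def logOverLogLog (r : ℝ) : ℝ := Real.log r / Real.log (Real.log r)

end

/-! ### Parity characters on the cube -/

noncomputable section

/-! Parity with noise on `S` has density proportional to `1 + 2β χ`, where `χ` is the product of the
spins over `S` and the label. Its Markov blankets are empty off this support of size `k + 1`, and on
it each consists of the remaining support; for the uniform law all are empty. Hence a structure
learner, followed by the test whether its matrix has a `true` entry, solves the testing problem in
the same time with error `1/200` on each side, whatever its sample complexity.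

It remains to realise these laws as RBMs with `λ₁ = k ^ O(k)`. As `χ = ±1`, the density is `D exp (J
χ)`. Summing out a hidden unit adds `log (2 cosh (b + ⟨w, x⟩))` to the log-density. Put one unit at
`w = t σ` for each sign vector `σ` on the support with a fixed parity: by symmetry the sum over `σ`
is a constant plus a multiple of `χ` (`sum_logTwoCosh_eq`). With a suitable bias the multiple is at
least `d ^ (-O(d))` for `t = 2 / d`, `d = k + 1` (`le_parityGap`), so enough copies and a smaller
`t` give exactly `J` (`exists_rbm_parity`). Columns have norm `t d ≤ 2`, and `λ₁` is at most the
number of units, `d ^ O(d)`.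

The information `η` depends on `β` only, so `log (λ₁ / η) / log log (λ₁ / η)` is of order `k`, and
the assumed bound `n ^ Ω(k)` carries over. -/

theorem spin_cast_mul_self (b : Bool) : (spin b : ℝ) * spin b = 1 := by
  cases b <;> simp [spin]

theorem abs_spin_cast (b : Bool) : |(spin b : ℝ)| = 1 := by
  cases b <;> simp [spin]

theorem spin_cast_beq (a b : Bool) : (spin (a == b) : ℝ) = spin a * spin b := by
  cases a <;> cases b <;> simp [spin]

/-- The sum over the cube of a product function is the product of the coordinate sums. -/
theorem sum_cube_prod {ι : Type*} [Fintype ι] [DecidableEq ι] (g : ι → Bool → ℝ) :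
    ∑ x : ι → Bool, ∏ s, g s (x s) = ∏ s, (g s true + g s false) := by
  have h := Finset.prod_univ_sum (fun _ : ι => (Finset.univ : Finset Bool)) g
  rw [Fintype.piFinset_univ] at h
  rw [← h]
  simp

/-- The parity character of a finite cube. -/
def character {ι : Type*} [Fintype ι] (x : ι → Bool) : ℝ := ∏ s, (spin (x s) : ℝ)

section Cube

variable {ι : Type*} [Fintype ι]

theorem character_mul_self (x : ι → Bool) : character x * character x = 1 := by
  simp [character, ← Finset.prod_mul_distrib, spin_cast_mul_self]

theorem abs_character (x : ι → Bool) : |character x| = 1 := by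
  simp [character, Finset.abs_prod, abs_spin_cast]

theorem character_beq (x y : ι → Bool) :
    character (fun s => x s == y s) = character x * character y := by
  simp [character, ← Finset.prod_mul_distrib, spin_cast_beq]

variable [DecidableEq ι]

/-- Coordinatewise multiplication by a fixed point of the cube. -/
def cubeShift {ι : Type*} (y : ι → Bool) : Equiv.Perm (ι → Bool) :=
  Function.Involutive.toPerm (fun x s => x s == y s) fun x => by
    funext s
    cases h : x s <;> cases h' : y s <;> simp [h, h']

theorem cubeShift_apply {ι : Type*} (y x : ι → Bool) : cubeShift y x = fun s => x s == y s := rfl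

/-! ### The parity coefficient of a hidden unit -/

/-- The logarithm of the partition function of a single hidden unit. -/
def logTwoCosh (z : ℝ) : ℝ := Real.log (2 * Real.cosh z)

theorem exp_logTwoCosh (z : ℝ) : Real.exp (logTwoCosh z) = Real.exp z + Real.exp (-z) := by
  rw [logTwoCosh, Real.exp_log (by have := Real.cosh_pos z; positivity), Real.cosh_eq]
  ring

/-- Isolates the affine part, which is orthogonal to the parity character in dimension at least 2;
the rest is nearly `exp (-2 z)` for large `z`, and an exponential factors over coordinates. -/
theorem logTwoCosh_eq (z : ℝ) : logTwoCosh z = z + Real.log (1 + Real.exp (-2 * z)) := by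
  apply Real.exp_injective
  rw [exp_logTwoCosh, Real.exp_add, Real.exp_log (by positivity), mul_add, ← Real.exp_add]
  ring_nf

theorem continuous_logTwoCosh : Continuous logTwoCosh := by
  unfold logTwoCosh
  refine Continuous.log (by fun_prop) fun z => ?_
  have := Real.cosh_pos z
  positivity

/-- The coefficient of the parity character in `x ↦ logTwoCosh (b + t ∑ x)`, times `2 ^ card ι`. -/
def parityGap (ι : Type*) [Fintype ι] [DecidableEq ι] (b t : ℝ) : ℝ :=
  ∑ x : ι → Bool, character x * logTwoCosh (b + t * ∑ s, (spin (x s) : ℝ))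

theorem sum_character [Nonempty ι] : ∑ x : ι → Bool, character x = 0 := by
  unfold character
  rw [sum_cube_prod (fun _ b => (spin b : ℝ))]
  simp [spin]

/-- Some coordinate `r ≠ s` still carries a bare spin, and its factor sums to zero. -/
theorem sum_character_mul_spin (hd : 2 ≤ Fintype.card ι) (s : ι) :
    ∑ x : ι → Bool, character x * (spin (x s) : ℝ) = 0 := by
  obtain ⟨r, hr⟩ := Fintype.exists_ne_of_one_lt_card (by omega) s
  have h : ∀ x : ι → Bool, character x * (spin (x s) : ℝ)
      = ∏ i, (spin (x i) : ℝ) * (if i = s then (spin (x i) : ℝ) else 1) := fun x => by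
    rw [Finset.prod_mul_distrib, character]
    simp
  simp_rw [h]
  rw [sum_cube_prod (fun i b => (spin b : ℝ) * (if i = s then (spin b : ℝ) else 1))]
  exact Finset.prod_eq_zero (Finset.mem_univ r) (by simp [hr, spin])

/-- Both factors split over coordinates, and each coordinate contributes `exp (-2 t) - exp (2 t) =
-2 sinh (2 t)`. -/
theorem sum_character_mul_exp (q t : ℝ) :
    ∑ x : ι → Bool, character x * (q * Real.exp (-2 * t * ∑ s, (spin (x s) : ℝ)))
      = (-1) ^ Fintype.card ι * (q * (2 * Real.sinh (2 * t)) ^ Fintype.card ι) := by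
  have h : ∀ x : ι → Bool, character x * (q * Real.exp (-2 * t * ∑ s, (spin (x s) : ℝ)))
      = q * ∏ s, ((spin (x s) : ℝ) * Real.exp (-2 * t * (spin (x s) : ℝ))) := fun x => by
    rw [Finset.prod_mul_distrib, Finset.mul_sum, Real.exp_sum, character]
    ring
  simp_rw [h]
  rw [← Finset.mul_sum, sum_cube_prod (fun _ b => (spin b : ℝ) * Real.exp (-2 * t * (spin b : ℝ)))]
  rw [Finset.prod_const, Finset.card_univ, mul_left_comm, ← mul_pow]
  congr 2
  simp only [spin, if_true, Bool.false_eq_true, if_false, Real.sinh_eq]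
  push_cast
  ring_nf

theorem abs_log_one_add_sub_le {u : ℝ} (hu : 0 ≤ u) : |Real.log (1 + u) - u| ≤ u ^ 2 / 2 := by
  have h1 : Real.log (1 + u) ≤ u := by
    have := Real.log_le_sub_one_of_pos (show 0 < 1 + u by linarith)
    linarith
  have h2 := Real.le_log_one_add_of_nonneg hu
  have h3 : u - u ^ 2 / 2 ≤ 2 * u / (u + 2) := by
    rw [le_div_iff₀ (by linarith)]
    have : 0 ≤ u ^ 3 := by positivity
    nlinarith
  rw [abs_le]
  constructor <;> nlinarith

/-- With hidden bias `- log q / 2`, the parity gap is that of `x ↦ q exp (-2 t ∑ x)` up to an error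
quadratic in `q`. -/
theorem le_parityGap (hd : 2 ≤ Fintype.card ι) {q t r : ℝ} (hq : 0 < q) (ht : 0 ≤ t)
    (hr : t * Fintype.card ι ≤ r) :
    q * (4 * t) ^ Fintype.card ι - 2 ^ Fintype.card ι * ((q * Real.exp (2 * r)) ^ 2 / 2)
      ≤ (-1) ^ Fintype.card ι * parityGap ι (-(Real.log q) / 2) t := by
  set d := Fintype.card ι with hdef
  have : Nonempty ι := Fintype.card_pos_iff.mp (by omega)
  set u : (ι → Bool) → ℝ := fun x => q * Real.exp (-2 * t * ∑ s, (spin (x s) : ℝ)) with hu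
  have hsum : ∀ x : ι → Bool, |∑ s, (spin (x s) : ℝ)| ≤ d := fun x => by
    refine (Finset.abs_sum_le_sum_abs _ _).trans ?_
    simp [abs_spin_cast, hdef]
  have hu0 : ∀ x, 0 ≤ u x := fun x => by positivity
  have hule : ∀ x, u x ≤ q * Real.exp (2 * r) := fun x => by
    refine mul_le_mul_of_nonneg_left (Real.exp_le_exp.mpr ?_) hq.le
    have := mul_le_mul_of_nonneg_left (neg_le_of_abs_le (hsum x)) ht
    nlinarith
  -- Since `u x = exp (-2 z)` for the unit's argument `z`, the affine part drops out, the linear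
  -- term in `u` is computed exactly, and the remainder of `log (1 + u)` is kept as the error.
  have hsplit : parityGap ι (-(Real.log q) / 2) t
      = (-1) ^ d * (q * (2 * Real.sinh (2 * t)) ^ d)
        + ∑ x : ι → Bool, character x * (Real.log (1 + u x) - u x) := by
    have hterm : ∀ x : ι → Bool,
        character x * logTwoCosh (-(Real.log q) / 2 + t * ∑ s, (spin (x s) : ℝ))
          = (-(Real.log q) / 2) * character x + t * ∑ s, character x * (spin (x s) : ℝ)
            + character x * u x + character x * (Real.log (1 + u x) - u x) := fun x => by
      have he : Real.exp (-2 * (-(Real.log q) / 2 + t * ∑ s, (spin (x s) : ℝ))) = u x := by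
        rw [hu]
        change _ = q * Real.exp (-2 * t * ∑ s, (spin (x s) : ℝ))
        conv_rhs => rw [← Real.exp_log hq]
        rw [← Real.exp_add]
        ring_nf
      rw [logTwoCosh_eq, he, ← Finset.mul_sum]
      ring
    unfold parityGap
    simp_rw [hterm]
    rw [Finset.sum_add_distrib, Finset.sum_add_distrib, Finset.sum_add_distrib, ← Finset.mul_sum,
      ← Finset.mul_sum, Finset.sum_comm, sum_character, sum_character_mul_exp]
    simp_rw [sum_character_mul_spin hd]
    simp [hdef]
  have herr : |∑ x : ι → Bool, character x * (Real.log (1 + u x) - u x)|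
      ≤ 2 ^ d * ((q * Real.exp (2 * r)) ^ 2 / 2) := by
    refine (Finset.abs_sum_le_sum_abs _ _).trans ?_
    have : ∀ x ∈ (Finset.univ : Finset (ι → Bool)),
        |character x * (Real.log (1 + u x) - u x)| ≤ (q * Real.exp (2 * r)) ^ 2 / 2 :=
      fun x _ => by
        rw [abs_mul, abs_character, one_mul]
        refine (abs_log_one_add_sub_le (hu0 x)).trans ?_
        have := pow_le_pow_left₀ (hu0 x) (hule x) 2
        linarith
    refine (Finset.sum_le_card_nsmul _ _ _ this).trans (le_of_eq ?_)
    simp [hdef]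
  have hsinh : (4 * t) ^ d ≤ (2 * Real.sinh (2 * t)) ^ d := by
    refine pow_le_pow_left₀ (by positivity) ?_ _
    have := Real.self_le_sinh_iff.mpr (show 0 ≤ 2 * t by positivity)
    linarith
  have hmain := mul_le_mul_of_nonneg_left hsinh hq.le
  have hsign : ((-1 : ℝ) ^ d) * (-1) ^ d = 1 := by rw [← mul_pow]; simp
  have hE : -(2 ^ d * ((q * Real.exp (2 * r)) ^ 2 / 2))
      ≤ (-1) ^ d * ∑ x : ι → Bool, character x * (Real.log (1 + u x) - u x) := by
    refine neg_le_of_abs_le ?_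
    rw [abs_mul]
    simpa using herr
  rw [hsplit, mul_add, ← mul_assoc, hsign, one_mul]
  linarith

theorem continuous_parityGap (b : ℝ) : Continuous (parityGap ι b) := by
  unfold parityGap
  refine continuous_finsetSum _ fun x _ => continuous_const.mul ?_
  exact continuous_logTwoCosh.comp (by fun_prop)

theorem parityGap_zero [Nonempty ι] (b : ℝ) : parityGap ι b 0 = 0 := by
  simp [parityGap, ← Finset.sum_mul, sum_character]

/-- For some hidden bias, every sufficiently small positive number is a parity gap. -/
theorem exists_parityGap_eq (ι : Type*) [Fintype ι] [DecidableEq ι] (hd : 2 ≤ Fintype.card ι) :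
    ∃ b : ℝ, ∀ y : ℝ, 0 ≤ y →
      y ≤ (32 / (Fintype.card ι : ℝ) ^ 2) ^ Fintype.card ι / (2 * Real.exp 8) →
      ∃ t : ℝ, 0 ≤ t ∧ t * Fintype.card ι ≤ 2 ∧
        (-1) ^ Fintype.card ι * parityGap ι b t = y := by
  have : Nonempty ι := Fintype.card_pos_iff.mp (by omega)
  set d := Fintype.card ι with hdef
  have hd0 : (0 : ℝ) < d := by
    have : 0 < d := by omega
    exact_mod_cast this
  -- This `q` maximises the bound of `le_parityGap` at `t = 2 / d`, `r = 2`, which is a quadratic in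
  -- `q`; the error is then half of the main term.
  set q : ℝ := (4 / (d : ℝ)) ^ d / Real.exp 8 with hq
  have hq0 : 0 < q := by positivity
  have h := le_parityGap (ι := ι) (t := 2 / d) (r := 2) hd hq0 (by positivity)
    (le_of_eq (by rw [← hdef]; field_simp))
  rw [← hdef] at h
  have hval : q * (4 * (2 / (d : ℝ))) ^ d - 2 ^ d * ((q * Real.exp (2 * 2)) ^ 2 / 2)
      = (32 / (d : ℝ) ^ 2) ^ d / (2 * Real.exp 8) := by
    have e1 : (4 * (2 / (d : ℝ))) ^ d = 2 ^ d * (4 / (d : ℝ)) ^ d := by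
      rw [← mul_pow]; ring_nf
    have e2 : (32 / (d : ℝ) ^ 2) ^ d = 2 ^ d * ((4 / (d : ℝ)) ^ d * (4 / (d : ℝ)) ^ d) := by
      rw [← mul_pow, ← mul_pow]
      congr 1
      field_simp
      norm_num
    have e3 : Real.exp (2 * 2) ^ 2 = Real.exp 8 := by
      rw [← Real.exp_nat_mul]; norm_num
    rw [e1, e2, mul_pow q, e3, hq]
    field_simp
    ring
  rw [hval] at h
  refine ⟨-(Real.log q) / 2, fun y hy0 hy => ?_⟩
  have hc : Continuous fun t => (-1 : ℝ) ^ d * parityGap ι (-(Real.log q) / 2) t :=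
    continuous_const.mul (continuous_parityGap _)
  -- The gap vanishes at `t = 0` and is at least the threshold at `t = 2 / d`, so intermediate
  -- values are attained exactly.
  obtain ⟨t, ht, hty⟩ := intermediate_value_Icc (show (0 : ℝ) ≤ 2 / d by positivity)
    hc.continuousOn (show y ∈ Set.Icc _ _ from ⟨by simpa [parityGap_zero] using hy0, hy.trans h⟩)
  refine ⟨t, ht.1, ?_, hty⟩
  have := mul_le_mul_of_nonneg_right ht.2 hd0.le
  rwa [div_mul_cancel₀ _ hd0.ne'] at this

/-- Summing `logTwoCosh (b + t ⟨σ, y⟩)` over all `σ` of parity `ε` gives a constant plus a multiple of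
the parity character. -/
theorem sum_logTwoCosh_eq (b t : ℝ) {ε : ℝ} (hε : ε * ε = 1) (y : ι → Bool) :
    ∑ x : {x : ι → Bool // character x = ε},
        logTwoCosh (b + t * ∑ s, (spin (x.1 s) : ℝ) * spin (y s))
      = (∑ x : ι → Bool, logTwoCosh (b + t * ∑ s, (spin (x s) : ℝ))) / 2
        + ε * parityGap ι b t / 2 * character y := by
  classical
  set f : (ι → Bool) → ℝ := fun x => logTwoCosh (b + t * ∑ s, (spin (x s) : ℝ) * spin (y s))
    with hf
  -- Shifting by `y` turns `⟨x, y⟩` into a plain sum of spins and multiplies the character by that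
  -- of `y`.
  have hfs : ∀ x, f x = logTwoCosh (b + t * ∑ s, (spin (cubeShift y x s) : ℝ)) := fun x => by
    simp [hf, cubeShift_apply, spin_cast_beq]
  have h1 : ∑ x, f x = ∑ x : ι → Bool, logTwoCosh (b + t * ∑ s, (spin (x s) : ℝ)) := by
    simp_rw [hfs]
    exact Equiv.sum_comp (cubeShift y) fun x => logTwoCosh (b + t * ∑ s, (spin (x s) : ℝ))
  have h2 : ∑ x, character x * f x = parityGap ι b t * character y := by
    have : ∀ x, character x * f x = (character (cubeShift y x)
        * logTwoCosh (b + t * ∑ s, (spin (cubeShift y x s) : ℝ))) * character y := fun x => by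
      rw [hfs, cubeShift_apply, character_beq]
      linear_combination (-(character x
        * logTwoCosh (b + t * ∑ s, (spin (x s == y s) : ℝ)))) * character_mul_self y
    simp_rw [this]
    rw [← Finset.sum_mul, Equiv.sum_comp (cubeShift y)
      fun x => character x * logTwoCosh (b + t * ∑ s, (spin (x s) : ℝ))]
    rfl
  -- The indicator of `character x = ε` is `(1 + ε * character x) / 2`.
  have h3 : ∑ x : {x : ι → Bool // character x = ε}, f x.1
      = ∑ x, (f x / 2 + ε / 2 * (character x * f x)) := by
    rw [← Finset.sum_subtype (Finset.univ.filter fun x => character x = ε) (by simp) f,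
      Finset.sum_filter]
    refine Finset.sum_congr rfl fun x _ => ?_
    rcases mul_self_eq_mul_self_iff.mp ((character_mul_self x).trans hε.symm) with hx | hx
    · rw [if_pos hx, hx]
      linear_combination (-(f x) / 2) * hε
    · rw [if_neg (fun h => by rw [h] at hx; nlinarith), hx]
      linear_combination (f x / 2) * hε
  rw [h3, Finset.sum_add_distrib, ← Finset.sum_div, ← Finset.mul_sum, h1, h2]
  ring

end Cube

/-! ### Visible laws of RBMs -/

namespace RBM

variable {N m : ℕ}

theorem visibleLaw_apply (R : RBM N m) (x : Fin N → Bool) :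
    R.visibleLaw x = ∑ h : Fin m → Bool, R.jointLaw (x, h) := by
  classical
  rw [visibleLaw, PMF.map_apply, tsum_fintype, Fintype.sum_prod_type, Finset.sum_comm]
  refine Finset.sum_congr rfl fun h _ => ?_
  exact (Finset.sum_eq_single x (fun y _ hy => if_neg (Ne.symm hy)) (by simp)).trans
    (if_pos rfl)

/-- The visible law is determined by the marginal weights up to a constant factor. -/
theorem visibleLaw_eq (R : RBM N m) (P : PMF (Fin N → Bool)) {K : ℝ} (hK : 0 ≤ K)
    (h : ∀ x, ∑ g : Fin m → Bool, Real.exp (R.potential x g) = K * (P x).toReal) :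
    R.visibleLaw = P := by
  set Z := ∑' z : (Fin N → Bool) × (Fin m → Bool),
    ENNReal.ofReal (Real.exp (R.potential z.1 z.2)) with hZ
  have hx : ∀ x, R.visibleLaw x = ENNReal.ofReal K * Z⁻¹ * P x := fun x => by
    rw [visibleLaw_apply]
    simp only [jointLaw, PMF.normalize_apply]
    rw [← Finset.sum_mul, ← ENNReal.ofReal_sum_of_nonneg fun _ _ => (Real.exp_pos _).le, h,
      ENNReal.ofReal_mul hK, ENNReal.ofReal_toReal (P.apply_ne_top x)]
    ring
  -- Both laws have total mass 1, so the factor between them is 1 and the partition function need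
  -- not be computed.
  have hone : ENNReal.ofReal K * Z⁻¹ = 1 := by
    have := R.visibleLaw.tsum_coe
    simp_rw [hx] at this
    rwa [ENNReal.tsum_mul_left, P.tsum_coe, mul_one] at this
  ext x
  rw [hx, hone, one_mul]

/-- Given `x`, the hidden units are independent, so the sum over them factors, with one factor `2
cosh` per unit. -/
theorem sum_exp_potential (R : RBM N m) (hv : ∀ i, R.visBias i = 0) (x : Fin N → Bool) :
    ∑ g : Fin m → Bool, Real.exp (R.potential x g)
      = Real.exp (∑ j, logTwoCosh (R.hidBias j + ∑ i, (spin (x i) : ℝ) * R.weight i j)) := by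
  have h : ∀ g : Fin m → Bool, Real.exp (R.potential x g)
      = ∏ j, Real.exp ((R.hidBias j + ∑ i, (spin (x i) : ℝ) * R.weight i j) * (spin (g j) : ℝ)) :=
    fun g => by
      rw [← Real.exp_sum, potential, Finset.sum_comm]
      simp [hv, add_mul, Finset.sum_add_distrib, Finset.sum_mul, add_comm]
  simp_rw [h]
  rw [sum_cube_prod (fun j b => Real.exp
    ((R.hidBias j + ∑ i, (spin (x i) : ℝ) * R.weight i j) * (spin b : ℝ))), Real.exp_sum]
  refine Finset.prod_congr rfl fun j _ => ?_
  rw [exp_logTwoCosh]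
  simp [spin]

/-- A crude row bound suffices: every `|tanh|` is below 1, so a row sums to at most the number of
hidden units. -/
theorem isBounded_of_weights (R : RBM N m) (hv : ∀ i, R.visBias i = 0) {lam1 lam2 : ℝ}
    (hm : (m : ℝ) ≤ lam1) (hW : ∀ j, ∑ i, |R.weight i j| ≤ lam2) : R.IsBounded lam1 lam2 := by
  refine ⟨fun i => ?_, hW⟩
  rw [hv, abs_zero, add_zero]
  refine (Finset.sum_le_card_nsmul _ _ 1 fun j _ => (Real.abs_tanh_lt_one _).le).trans ?_
  simpa using hm

end RBM

/-! ### Parity interactions from hidden units -/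

/-- The product of the spins over `S`. -/
def spinProd {N : ℕ} (S : Finset (Fin N)) (x : Fin N → Bool) : ℝ := ∏ s ∈ S, (spin (x s) : ℝ)

theorem spinProd_eq_character {N : ℕ} (S : Finset (Fin N)) (x : Fin N → Bool) :
    spinProd S x = character fun s : S => x s := by
  rw [spinProd, character, ← Finset.prod_coe_sort]

/-- The law with density `exp (J ∏ s ∈ S, x_s)` is the visible law of an RBM with columns of norm at
most `2` and `|S| ^ O(|S|)` hidden units. -/
theorem exists_rbm_parity {N : ℕ} (S : Finset (Fin N)) (hS : 2 ≤ S.card) {J : ℝ} (hJ : 0 < J) :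
    ∃ (m : ℕ) (R : RBM N m) (K : ℝ), 0 < K ∧
      (∀ x, ∑ g : Fin m → Bool, Real.exp (R.potential x g) = K * Real.exp (J * spinProd S x)) ∧
      (∀ i, R.visBias i = 0) ∧ (∀ j, ∑ i, |R.weight i j| ≤ 2) ∧
      (m : ℝ) ≤ (4 * J * Real.exp 8 + 1) * (S.card : ℝ) ^ (2 * S.card) := by
  classical
  set d := S.card with hd
  have hd2 : (2 : ℝ) ≤ d := by exact_mod_cast hS
  have hcard : Fintype.card S = d := by simp [hd]
  obtain ⟨b, hb⟩ := exists_parityGap_eq S (by omega)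
  rw [hcard] at hb
  set δ : ℝ := (32 / (d : ℝ) ^ 2) ^ d / (2 * Real.exp 8) with hδ
  have hδ0 : 0 < δ := by positivity
  set M : ℕ := ⌈2 * J / δ⌉₊ with hM
  have hM0 : (0 : ℝ) < M := by
    have : 0 < M := Nat.ceil_pos.mpr (by positivity)
    exact_mod_cast this
  have hMle : 2 * J / δ ≤ M := Nat.le_ceil _
  obtain ⟨t, ht0, htd, hgap⟩ := hb (2 * J / M) (by positivity) (by
    rw [div_le_iff₀ hM0, mul_comm δ]
    rwa [div_le_iff₀ hδ0] at hMle)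
  -- The parity class for which the coefficient `ε * parityGap / 2` is positive, namely `J / M`.
  set ε : ℝ := (-1) ^ d with hε
  have hεε : ε * ε = 1 := by rw [hε, ← mul_pow]; simp
  set κ := Fin M × {σ : S → Bool // character σ = ε} with hκ
  let e : Fin (Fintype.card κ) ≃ κ := (Fintype.equivFin κ).symm
  let R : RBM N (Fintype.card κ) :=
    { weight := fun i j => if h : i ∈ S then t * (spin ((e j).2.1 ⟨i, h⟩) : ℝ) else 0
      visBias := fun _ => 0
      hidBias := fun _ => b }
  have hsumS : ∀ f : Fin N → ℝ, (∀ i ∉ S, f i = 0) → ∑ i, f i = ∑ s : S, f s := fun f hf => by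
    rw [Finset.sum_coe_sort S f]
    exact (Finset.sum_subset (Finset.subset_univ S) fun i _ hi => hf i hi).symm
  refine ⟨_, R, Real.exp (M * ((∑ x : S → Bool,
    logTwoCosh (b + t * ∑ s, (spin (x s) : ℝ))) / 2)), Real.exp_pos _, fun x => ?_, fun _ => rfl,
    fun j => ?_, ?_⟩
  · rw [R.sum_exp_potential (fun _ => rfl), ← Real.exp_add]
    congr 1
    have hj : ∀ j, R.hidBias j + ∑ i, (spin (x i) : ℝ) * R.weight i j
        = b + t * ∑ s : S, (spin ((e j).2.1 s) : ℝ) * spin (x s) := fun j => by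
      rw [hsumS _ fun i hi => by simp [R, hi], Finset.mul_sum]
      refine congrArg (b + ·) (Finset.sum_congr rfl fun s _ => ?_)
      simp only [R, Finset.coe_mem, dite_true]
      ring
    simp_rw [hj]
    rw [Equiv.sum_comp e fun p : κ =>
      logTwoCosh (b + t * ∑ s : S, (spin (p.2.1 s) : ℝ) * spin (x s)), Fintype.sum_prod_type]
    simp only
    rw [sum_logTwoCosh_eq b t hεε fun s : S => x s, hgap, spinProd_eq_character]
    simp only [Finset.sum_const, Finset.card_univ, Fintype.card_fin, nsmul_eq_mul]
    field_simp
  · rw [hsumS _ fun i hi => by simp [R, hi]]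
    refine le_of_eq_of_le ?_ htd
    have : ∀ s : S, |R.weight s j| = t := fun s => by
      simp [R, abs_mul, abs_spin_cast, abs_of_nonneg ht0]
    simp_rw [this]
    simp [hd, mul_comm]
  · have hκc : (Fintype.card κ : ℝ) ≤ M * 2 ^ d := by
      have h1 : Fintype.card {σ : S → Bool // character σ = ε} ≤ 2 ^ d := by
        refine (Fintype.card_subtype_le _).trans ?_
        simp [hd]
      have h2 : Fintype.card κ = M * Fintype.card {σ : S → Bool // character σ = ε} := by
        simp only [hκ, Fintype.card_prod, Fintype.card_fin]
      rw [h2]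
      exact_mod_cast Nat.mul_le_mul_left M h1
    have hMlt : (M : ℝ) ≤ 2 * J / δ + 1 := (Nat.ceil_lt_add_one (by positivity)).le
    have hδe : 2 * J / δ * 32 ^ d = 4 * J * Real.exp 8 * (d : ℝ) ^ (2 * d) := by
      rw [hδ, div_pow, pow_mul]
      field_simp
      ring
    have h2d : (2 : ℝ) ^ d ≤ (d : ℝ) ^ (2 * d) := by
      rw [pow_mul]
      exact pow_le_pow_left₀ (by norm_num) (by nlinarith) d
    have h32 : (2 : ℝ) ^ d ≤ 32 ^ d := pow_le_pow_left₀ (by norm_num) (by norm_num) d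
    calc (Fintype.card κ : ℝ) ≤ (2 * J / δ + 1) * 2 ^ d :=
          hκc.trans (mul_le_mul_of_nonneg_right hMlt (by positivity))
      _ ≤ 2 * J / δ * 32 ^ d + (d : ℝ) ^ (2 * d) := by
          rw [add_mul, one_mul]
          exact add_le_add (mul_le_mul_of_nonneg_left h32 (by positivity)) h2d
      _ = _ := by rw [hδe]; ring

/-! ### Parity laws -/

/-- The law on the cube with probabilities `2 ^ (-N) (1 + a ∏ s ∈ S, x_s)`. -/
def IsTiltedParity {N : ℕ} (P : PMF (Fin N → Bool)) (S : Finset (Fin N)) (a : ℝ) : Prop :=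
  ∀ x, (P x).toReal = (1 / 2) ^ N * (1 + a * spinProd S x)

theorem isTiltedParity_uniform {N : ℕ} (S : Finset (Fin N)) :
    IsTiltedParity (PMF.uniformOfFintype (Fin N → Bool)) S 0 := fun x => by
  simp

theorem spinProd_mul_self {N : ℕ} (S : Finset (Fin N)) (x : Fin N → Bool) :
    spinProd S x * spinProd S x = 1 := by
  simp [spinProd, ← Finset.prod_mul_distrib, spin_cast_mul_self]

theorem spinProd_eq_or {N : ℕ} (S : Finset (Fin N)) (x : Fin N → Bool) :
    spinProd S x = 1 ∨ spinProd S x = -1 :=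
  mul_self_eq_one_iff.mp (spinProd_mul_self S x)

/-- The coordinates of a parity with noise on `S` that carry the parity: those of `S` and the label. -/
def paritySupport {n : ℕ} (S : Finset (Fin n)) : Finset (Fin (n + 1)) :=
  insert (Fin.last n) (S.map Fin.castSuccEmb)

theorem card_paritySupport {n : ℕ} (S : Finset (Fin n)) :
    (paritySupport S).card = S.card + 1 := by
  rw [paritySupport, Finset.card_insert_of_notMem, Finset.card_map]
  simp [Fin.castSucc_ne_last]

theorem spinProd_paritySupport {n : ℕ} (S : Finset (Fin n)) (z : Fin (n + 1) → Bool) :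
    spinProd (paritySupport S) z
      = (spin (z (Fin.last n)) : ℝ) * (spin (parityBit S (Fin.init z)) : ℝ) := by
  rw [spinProd, paritySupport, Finset.prod_insert (by simp [Fin.castSucc_ne_last]),
    Finset.prod_map]
  congr 1
  have h : (∏ s ∈ S, spin (Fin.init z s)) * (∏ s ∈ S, spin (Fin.init z s)) = 1 := by
    rw [← Finset.prod_mul_distrib]
    refine Finset.prod_eq_one fun s _ => ?_
    cases Fin.init z s <;> simp [spin]
  have h' : (∏ s ∈ S, (spin (z (Fin.castSuccEmb s)) : ℝ))
      = ((∏ s ∈ S, spin (Fin.init z s) : ℤ) : ℝ) := by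
    push_cast
    rfl
  rw [h']
  rcases mul_self_eq_one_iff.mp h with h | h <;> rw [parityBit, h] <;> norm_num [spin]

theorem parityLaw_apply {n : ℕ} (beta : Set.Ioo (0 : ℝ) (1 / 2)) (S : Finset (Fin n))
    (z : Fin (n + 1) → Bool) :
    parityLaw beta S z = (2 ^ n : ENNReal)⁻¹ *
      biasedBit beta (z (Fin.last n) == parityBit S (Fin.init z)) := by
  rw [parityLaw, PMF.bind_apply, tsum_fintype, Finset.sum_eq_single (Fin.init z)]
  · rw [PMF.uniformOfFintype_apply, PMF.map_apply, tsum_fintype,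
      Finset.sum_eq_single (z (Fin.last n) == parityBit S (Fin.init z))]
    · rw [if_pos]
      · simp
      · conv_lhs => rw [← Fin.snoc_init_self z]
        congr 1
        cases z (Fin.last n) <;> cases parityBit S (Fin.init z) <;> rfl
    · intro b _ hb
      refine if_neg fun h => hb ?_
      have := congrFun h (Fin.last n)
      rw [Fin.snoc_last] at this
      rw [this]
      cases b <;> cases parityBit S (Fin.init z) <;> rfl
    · simp
  · intro x _ hx
    rw [PMF.map_apply, ENNReal.tsum_eq_zero.mpr, mul_zero]
    intro b
    refine if_neg fun h => hx ?_
    rw [h, Fin.init_snoc]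
  · simp

theorem isTiltedParity_parityLaw {n : ℕ} (beta : Set.Ioo (0 : ℝ) (1 / 2)) (S : Finset (Fin n)) :
    IsTiltedParity (parityLaw beta S) (paritySupport S) (2 * beta.1) := fun z => by
  have h1 := beta.2.1
  have h2 := beta.2.2
  rw [parityLaw_apply, spinProd_paritySupport, ENNReal.toReal_mul, biasedBit, PMF.ofFintype_apply,
    ENNReal.toReal_inv, ENNReal.toReal_pow]
  have h3 : (ENNReal.ofReal (1 / 2 + beta.1)).toReal = 1 / 2 + beta.1 :=
    ENNReal.toReal_ofReal (by linarith)
  have h4 : (ENNReal.ofReal (1 / 2 - beta.1)).toReal = 1 / 2 - beta.1 :=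
    ENNReal.toReal_ofReal (by linarith)
  rw [ENNReal.toReal_ofNat, apply_ite ENNReal.toReal, h3, h4, ← inv_pow, pow_succ]
  cases z (Fin.last n) <;> cases parityBit S (Fin.init z) <;> simp [spin] <;> ring

/-- If some coordinate of `T` is left free by the condition on `A`, summing over its two values
cancels everything; otherwise the character is constant on the cylinder. -/
theorem sum_spinProd_agree {N : ℕ} (A T : Finset (Fin N)) (x : Fin N → Bool) :
    (1 / 2 : ℝ) ^ N * ∑ y : Fin N → Bool with (∀ a ∈ A, y a = x a), spinProd T y
      = (1 / 2) ^ A.card * if T ⊆ A then spinProd T x else 0 := by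
  classical
  let g : Fin N → Bool → ℝ := fun i b =>
    (if i ∈ A then (if b = x i then 1 / 2 else 0) else 1 / 2) * (if i ∈ T then (spin b : ℝ) else 1)
  have h : ∀ y : Fin N → Bool, (1 / 2 : ℝ) ^ N * (if ∀ a ∈ A, y a = x a then spinProd T y else 0)
      = ∏ i, g i (y i) := fun y => by
    rw [Finset.prod_mul_distrib, Finset.prod_ite_mem, Finset.univ_inter, ← spinProd]
    split_ifs with hy
    · congr 1
      rw [Finset.prod_congr rfl (g := fun _ => (1 / 2 : ℝ)) fun i _ => ?_]
      · simp
      · split_ifs with hi hi'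
        · rfl
        · exact absurd (hy i hi) hi'
        · rfl
    · push Not at hy
      obtain ⟨a, ha, hya⟩ := hy
      rw [Finset.prod_eq_zero (Finset.mem_univ a) (by simp [ha, hya]), zero_mul, mul_zero]
  rw [Finset.sum_filter, Finset.mul_sum]
  simp_rw [h]
  rw [sum_cube_prod]
  have hg : ∀ i, g i true + g i false
      = if i ∈ A then 1 / 2 * (if i ∈ T then (spin (x i) : ℝ) else 1)
        else if i ∈ T then 0 else 1 := fun i => by
    by_cases hA : i ∈ A <;> by_cases hT : i ∈ T <;> cases hx : x i <;>
      simp [g, hA, hT, hx, spin] <;> norm_num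
  simp_rw [hg]
  split_ifs with hTA
  · have : ∀ i, (if i ∈ A then 1 / 2 * (if i ∈ T then (spin (x i) : ℝ) else 1)
        else if i ∈ T then 0 else 1)
        = (if i ∈ A then (1 / 2 : ℝ) else 1) * (if i ∈ T then (spin (x i) : ℝ) else 1) :=
      fun i => by
        by_cases hA : i ∈ A
        · simp [hA]
        · simp [hA, show i ∉ T from fun hT => hA (hTA hT)]
    simp_rw [this]
    rw [Finset.prod_mul_distrib, Finset.prod_ite_mem, Finset.prod_ite_mem, Finset.univ_inter,
      Finset.univ_inter, Finset.prod_const, spinProd]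
  · obtain ⟨a, haT, haA⟩ := Finset.not_subset.mp hTA
    rw [Finset.prod_eq_zero (Finset.mem_univ a) (by simp [haT, haA]), mul_zero]

namespace IsTiltedParity

variable {N : ℕ} {P : PMF (Fin N → Bool)} {S : Finset (Fin N)} {a : ℝ}

/-- The density is a combination of the characters of `∅` and `S`; a marginal retains the latter
only if it sees all of `S`. -/
theorem marginal_eq (hP : IsTiltedParity P S a) (A : Finset (Fin N)) (x : Fin N → Bool) :
    marginal P A x = (1 / 2) ^ A.card * (1 + if S ⊆ A then a * spinProd S x else 0) := by
  have h0 := sum_spinProd_agree A ∅ x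
  have hS := sum_spinProd_agree A S x
  have hP' : ∀ y, (P y).toReal
      = (1 / 2) ^ N * spinProd ∅ y + a * ((1 / 2) ^ N * spinProd S y) := fun y => by
    rw [hP y]
    simp only [spinProd, Finset.prod_empty]
    ring
  rw [marginal]
  simp_rw [hP']
  rw [Finset.sum_add_distrib, ← Finset.mul_sum, ← Finset.mul_sum, ← Finset.mul_sum, h0, hS]
  simp only [Finset.empty_subset, if_true]
  split_ifs <;> simp only [spinProd, Finset.prod_empty] <;> ring

theorem separates_iff (hP : IsTiltedParity P S a) (ha : |a| < 1) {i : Fin N}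
    {A : Finset (Fin N)} (hi : i ∉ A) :
    Separates P i A ↔ a = 0 ∨ i ∉ S ∨ S.erase i ⊆ A := by
  have hN : 0 < N := i.pos
  have hcard : (1 / 2 : ℝ) ^ (insert i A).card * (1 / 2) ^ (Finset.univ.erase i).card
      = (1 / 2) ^ (Finset.univ : Finset (Fin N)).card * (1 / 2) ^ A.card := by
    rw [Finset.card_insert_of_notMem hi, Finset.card_erase_of_mem (Finset.mem_univ i),
      Finset.card_univ, Fintype.card_fin, ← pow_add, ← pow_add]
    congr 1
    omega
  have hpos : (0 : ℝ) < (1 / 2) ^ (Finset.univ : Finset (Fin N)).card * (1 / 2) ^ A.card := by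
    positivity
  have hiA : S ⊆ Finset.univ.erase i ↔ i ∉ S := by
    simp [Finset.subset_erase]
  have key : Separates P i A ↔ ∀ x : Fin N → Bool,
      (1 + a * spinProd S x) * (1 + if S ⊆ A then a * spinProd S x else 0)
        = (1 + if S.erase i ⊆ A then a * spinProd S x else 0)
          * (1 + if i ∉ S then a * spinProd S x else 0) := by
    refine forall_congr' fun x => ?_
    simp only [hP.marginal_eq, Finset.subset_univ, if_true, hiA, Finset.subset_insert_iff]
    constructor
    · intro h
      refine mul_left_cancel₀ hpos.ne' ?_
      linear_combination h + (1 + if S.erase i ⊆ A then a * spinProd S x else 0)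
        * (1 + if i ∉ S then a * spinProd S x else 0) * hcard
    · intro h
      linear_combination (1 / 2) ^ (Finset.univ : Finset (Fin N)).card * (1 / 2) ^ A.card * h
        - (1 + if S.erase i ⊆ A then a * spinProd S x else 0)
          * (1 + if i ∉ S then a * spinProd S x else 0) * hcard
  rw [key]
  by_cases hiS : i ∈ S
  · have hSA : ¬ S ⊆ A := fun h => hi (h hiS)
    by_cases he : S.erase i ⊆ A
    · simp [hSA, he, hiS]
    · simp only [hSA, he, hiS, if_false, not_true, or_false]
      constructor
      -- Here the identity reads `1 + a χ = 1`; one point of the cube already forces `a = 0`.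
      · intro h
        have := h fun _ => true
        simpa [spinProd, spin] using this
      · rintro rfl
        simp
  · simp [hiS, mul_comm]

/-- In a parity law with a nontrivial tilt, the Markov blanket of a coordinate of the parity consists
of the other ones. -/
theorem isMarkovBlanket_iff (hP : IsTiltedParity P S a) (ha : |a| < 1) (i : Fin N)
    (B : Finset (Fin N)) :
    IsMarkovBlanket P i B ↔ B = if a = 0 ∨ i ∉ S then ∅ else S.erase i := by
  set B₀ : Finset (Fin N) := if a = 0 ∨ i ∉ S then ∅ else S.erase i with hB₀
  -- The separating sets are exactly those that contain `B₀`, so the minimal one is unique.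
  have h : ∀ A : Finset (Fin N), (i ∉ A ∧ Separates P i A) ↔ (i ∉ A ∧ B₀ ⊆ A) := fun A => by
    refine and_congr_right fun hi => ?_
    rw [hP.separates_iff ha hi, hB₀, ← or_assoc]
    split_ifs with hc <;> simp [hc]
  have hi₀ : i ∉ B₀ := by
    rw [hB₀]
    split_ifs <;> simp
  rw [IsMarkovBlanket]
  simp_rw [h]
  constructor
  · intro hB
    exact Finset.Subset.antisymm (hB.2 ⟨hi₀, subset_rfl⟩ hB.1.2) hB.1.2
  · rintro rfl
    exact ⟨⟨hi₀, subset_rfl⟩, fun A hA _ => hA.2⟩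

/-- Each of the three marginals misses a coordinate of `S` and is therefore uniform, so the ratio in
the logarithm is `1 + a χ`. Under the uniform law `χ` is balanced, which leaves the average over `χ
= ±1`. -/
theorem condMutualInfo_eq (hP : IsTiltedParity P S a) (ha : |a| < 1) {i j : Fin N} (hij : i ≠ j)
    (hi : i ∈ S) (hj : j ∈ S) :
    condMutualInfo P i j
      = ((1 + a) * Real.log (1 + a) + (1 - a) * Real.log (1 - a)) / 2 := by
  obtain ⟨ha1, ha2⟩ := abs_lt.mp ha
  set u := (1 + a) * Real.log (1 + a) with hu
  set v := (1 - a) * Real.log (1 - a) with hv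
  have hterm : ∀ x : Fin N → Bool, (P x).toReal *
      Real.log ((P x).toReal * marginal P ((Finset.univ.erase i).erase j) x
        / (marginal P (Finset.univ.erase j) x * marginal P (Finset.univ.erase i) x))
      = (u + v) / 2 * ((1 / 2) ^ N) + (u - v) / 2 * ((1 / 2) ^ N * spinProd S x) := fun x => by
    have hji : j ∈ Finset.univ.erase i := by simp [hij.symm]
    have h1 : ¬ S ⊆ (Finset.univ.erase i).erase j := fun h => by simpa using h hj
    have h2 : ¬ S ⊆ Finset.univ.erase j := fun h => by simpa using h hj
    have h3 : ¬ S ⊆ Finset.univ.erase i := fun h => by simpa using h hi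
    obtain ⟨M, rfl⟩ : ∃ M, N = M + 2 := by
      refine ⟨N - 2, ?_⟩
      have := i.isLt
      have := j.isLt
      have : (i : ℕ) ≠ j := fun h => hij (Fin.ext h)
      omega
    rw [hP.marginal_eq, hP.marginal_eq, hP.marginal_eq, if_neg h1, if_neg h2, if_neg h3, hP x,
      Finset.card_erase_of_mem hji, Finset.card_erase_of_mem (Finset.mem_univ i),
      Finset.card_erase_of_mem (Finset.mem_univ j), Finset.card_univ, Fintype.card_fin]
    have : ((1 / 2 : ℝ) ^ (M + 2) * (1 + a * spinProd S x) * ((1 / 2) ^ (M + 2 - 1 - 1) * (1 + 0))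
        / ((1 / 2) ^ (M + 2 - 1) * (1 + 0) * ((1 / 2) ^ (M + 2 - 1) * (1 + 0))))
        = 1 + a * spinProd S x := by
      simp only [Nat.add_sub_cancel, show M + 2 - 1 = M + 1 by omega, pow_succ, add_zero, mul_one]
      field_simp
    rw [this]
    rcases spinProd_eq_or S x with h | h <;> rw [h]
    · rw [mul_one, hu]; ring
    · rw [show 1 + a * -1 = 1 - a by ring, hv]; ring
  have hne : ¬ S ⊆ ∅ := fun h => by simpa using h hi
  have hbal := sum_spinProd_agree ∅ S fun _ => true
  simp only [hne, if_false, mul_zero, Finset.notMem_empty, false_imp_iff, imp_true_iff,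
    Finset.filter_true] at hbal
  rw [condMutualInfo]
  simp_rw [hterm]
  rw [Finset.sum_add_distrib, ← Finset.mul_sum, ← Finset.mul_sum, ← Finset.mul_sum, hbal]
  simp [Finset.card_univ]

theorem allNondegenerate (hP : IsTiltedParity P S a) (ha : |a| < 1) :
    AllNondegenerate P (((1 + a) * Real.log (1 + a) + (1 - a) * Real.log (1 - a)) / 2) := by
  rintro i j ⟨B, hB, hj⟩
  rw [hP.isMarkovBlanket_iff ha] at hB
  rw [hB] at hj
  split_ifs at hj with hc
  · simp at hj
  · push Not at hc
    rw [Finset.mem_erase] at hj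
    exact Or.inl (hP.condMutualInfo_eq ha hj.1.symm hc.2 hj.2).ge

end IsTiltedParity

/-- This is `log v < v - 1` at `v = 1 / u`. Used at `1 + a` and `1 - a`, where the lower bounds `a`
and `-a` cancel. -/
theorem sub_one_lt_mul_log {u : ℝ} (hu : 0 < u) (hu1 : u ≠ 1) : u - 1 < u * Real.log u := by
  have h := Real.log_lt_sub_one_of_pos (inv_pos.mpr hu) (by simpa using hu1)
  rw [Real.log_inv] at h
  have := mul_lt_mul_of_pos_left h hu
  rw [mul_sub, mul_inv_cancel₀ hu.ne'] at this
  linarith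

theorem tilt_information_pos {a : ℝ} (ha : |a| < 1) (ha0 : a ≠ 0) :
    0 < ((1 + a) * Real.log (1 + a) + (1 - a) * Real.log (1 - a)) / 2 := by
  obtain ⟨ha1, ha2⟩ := abs_lt.mp ha
  have h1 := sub_one_lt_mul_log (show 0 < 1 + a by linarith) (by simpa using ha0)
  have h2 := sub_one_lt_mul_log (show 0 < 1 - a by linarith) (by simpa using ha0)
  linarith

/-! ### Encoded structures -/

theorem mem_encodeNeighborhoods {N : ℕ} (nb : Fin N → Finset (Fin N)) :
    true ∈ encodeNeighborhoods nb ↔ ∃ i j, j ∈ nb i := by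
  simp [encodeNeighborhoods]

theorem IsTiltedParity.true_mem_of_correct {N : ℕ} {P : PMF (Fin N → Bool)} {S : Finset (Fin N)}
    {a : ℝ} (hP : IsTiltedParity P S a) (ha : |a| < 1) (ha0 : a ≠ 0) (hS : 1 < S.card)
    {w : List Bool} (hw : w ∈ correctStructures P) : true ∈ w := by
  obtain ⟨nb, rfl, hnb⟩ := hw
  obtain ⟨i, hi, j, hj, hij⟩ := Finset.one_lt_card.mp hS
  refine (mem_encodeNeighborhoods nb).mpr ⟨i, j, ?_⟩
  rw [(hP.isMarkovBlanket_iff ha i _).mp (hnb i), if_neg (by simp [ha0, hi])]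
  exact Finset.mem_erase.mpr ⟨hij.symm, hj⟩

theorem IsTiltedParity.true_notMem_of_correct {N : ℕ} {P : PMF (Fin N → Bool)}
    {S : Finset (Fin N)} (hP : IsTiltedParity P S 0)
    {w : List Bool} (hw : w ∈ correctStructures P) : true ∉ w := by
  obtain ⟨nb, rfl, hnb⟩ := hw
  rw [mem_encodeNeighborhoods]
  rintro ⟨i, j, hj⟩
  rw [(hP.isMarkovBlanket_iff (by simp) i _).mp (hnb i), if_pos (Or.inl rfl)] at hj
  simp at hj

theorem PMF.toOuterMeasure_add_compl {α : Type*} (p : PMF α) (s : Set α) :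
    p.toOuterMeasure s + p.toOuterMeasure sᶜ = 1 := by
  rw [PMF.toOuterMeasure_apply, PMF.toOuterMeasure_apply, ← ENNReal.tsum_add, ← p.tsum_coe]
  exact tsum_congr fun x => Set.indicator_self_add_compl_apply s p x

theorem PMF.toOuterMeasure_apply_ne_top {α : Type*} (p : PMF α) (s : Set α) :
    p.toOuterMeasure s ≠ ⊤ := fun h => by
  have := p.toOuterMeasure_add_compl s
  simp [h] at this

/-! ### From a structure learner to a parity tester -/

namespace SampleTM

/-- The machine that runs `M`, outputs nothing while `M` is running, and on halting outputs the single
bit that tells whether `M` has output a `true`. -/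
def anyTrue (M : SampleTM) : SampleTM where
  State := M.State × Bool
  Symbol := M.Symbol
  tapes := M.tapes
  finState := inferInstance
  finSymbol := M.finSymbol
  blank := M.blank
  start := (M.start, false)
  step q coin i s w :=
    let a := M.step q.1 coin i s w
    -- The bit emitted in the current step is included, so the final answer also covers a `true`
    -- emitted on halting.
    let flag := q.2 || decide (true ∈ a.emit.toList)
    { next := a.next.map fun q' => (q', flag)
      write := a.write
      move := a.move
      inputMove := a.inputMove
      sampleMove := a.sampleMove
      request := a.request
      emit := if a.next.isNone then some flag else none }

/-- The configuration of `M.anyTrue` that corresponds to a configuration of `M`. -/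
def anyTrueCfg {M : SampleTM} (c : M.Cfg) : M.anyTrue.Cfg where
  state := c.state.map fun q => (q, decide (true ∈ c.output))
  input := c.input
  sample := c.sample
  work := c.work
  output := if c.state.isNone then [decide (true ∈ c.output)] else []

theorem anyTrueCfg_init (M : SampleTM) (w : List Bool) :
    anyTrueCfg (M.init w) = M.anyTrue.init w := by
  simp only [anyTrueCfg, init, anyTrue, List.not_mem_nil, decide_false]
  rfl

theorem anyTrueCfg_apply {M : SampleTM} (c : M.Cfg) {q : M.State} (hq : c.state = some q)
    (coin : Bool) (i s : Option Bool) (w : Fin M.tapes → M.Symbol)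
    (tape : Turing.Tape (Option Bool)) :
    (anyTrueCfg c).apply (M.anyTrue.step (q, decide (true ∈ c.output)) coin i s w) tape
      = anyTrueCfg (c.apply (M.step q coin i s w) tape) := by
  simp only [anyTrueCfg, Cfg.apply, anyTrue, hq, List.mem_append, Bool.decide_or,
    Option.isNone_some, List.nil_append, Bool.false_eq_true, if_false]
  congr 1
  cases (M.step q coin i s w).next <;> simp

/-- `anyTrueCfg` intertwines the two Markov chains, so the tester follows the learner step for step
and has the same runtime. -/
theorem stepLaw_anyTrue {N : ℕ} (M : SampleTM) (D : PMF (Fin N → Bool)) (c : M.Cfg) :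
    M.anyTrue.stepLaw D (anyTrueCfg c) = (M.stepLaw D c).map anyTrueCfg := by
  cases hc : c.state with
  | none =>
    have h : (anyTrueCfg c).state = none := by simp only [anyTrueCfg, hc]; rfl
    simp only [stepLaw, h, hc, PMF.pure_map]
  | some q =>
    have h : (anyTrueCfg c).state = some (q, decide (true ∈ c.output)) := by
      simp only [anyTrueCfg, hc]; rfl
    simp only [stepLaw, h, hc, PMF.map_bind]
    congr 1
    funext coin
    rw [apply_ite (PMF.map anyTrueCfg), PMF.map_comp, PMF.pure_map]
    simp only [Function.comp_def, ← anyTrueCfg_apply c hc]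
    rfl

theorem run_anyTrue {N : ℕ} (M : SampleTM) (D : PMF (Fin N → Bool)) (w : List Bool) (t : ℕ) :
    M.anyTrue.run D w t = (M.run D w t).map anyTrueCfg := by
  induction t with
  | zero => simp [run, PMF.pure_map, anyTrueCfg_init]
  | succ t ih =>
    rw [run, run, ih, PMF.map_bind, PMF.bind_map]
    congr 1
    funext c
    exact stepLaw_anyTrue M D c

variable {N : ℕ} {M : SampleTM} {D : PMF (Fin N → Bool)} {w : List Bool} {t : ℕ}

theorem HaltsWithin.anyTrue (h : M.HaltsWithin D w t) : M.anyTrue.HaltsWithin D w t := by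
  intro c hc
  rw [run_anyTrue, PMF.support_map] at hc
  obtain ⟨c', hc', rfl⟩ := hc
  simp only [anyTrueCfg, h c' hc']
  rfl

/-- Once `M` has halted, a final bit other than `b` means that the output of `M` is outside `E`. -/
theorem outputProb_anyTrue_le (h : M.HaltsWithin D w t) {E : Set (List Bool)} {b : Bool} {p : ℝ}
    (hE : ∀ v ∈ E, decide (true ∈ v) = b) (hp : p ≤ M.outputProb D w t E) :
    M.anyTrue.outputProb D w t {[b]}ᶜ ≤ 1 - p := by
  have hsub : M.anyTrue.outputProb D w t {[b]}ᶜ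
      ≤ ((M.run D w t).toOuterMeasure {c | c.output ∈ E}ᶜ).toReal := by
    rw [outputProb, run_anyTrue, PMF.toOuterMeasure_map_apply]
    refine ENNReal.toReal_mono (PMF.toOuterMeasure_apply_ne_top _ _)
      (PMF.toOuterMeasure_mono _ ?_)
    rintro c ⟨hc, hsupp⟩ hcE
    refine hc ?_
    simp [anyTrueCfg, h c hsupp, hE _ hcE]
  have hadd := congrArg ENNReal.toReal
    (PMF.toOuterMeasure_add_compl (M.run D w t) {c | c.output ∈ E})
  rw [ENNReal.toReal_add (PMF.toOuterMeasure_apply_ne_top _ _)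
    (PMF.toOuterMeasure_apply_ne_top _ _), ENNReal.toReal_one] at hadd
  rw [outputProb] at hp
  linarith

end SampleTM

/-! ### Choice of the bound and of the class -/

/-- With `l = log (k + 3) ≥ 1` and `r` the given power, `log r = C (k + 1) l`, while `log log r`
lies between `l` and `(log C + 2) l`; so `l` cancels in the quotient. -/
theorem logOverLogLog_pow_bounds {C k : ℕ} (hC : 3 ≤ C) (hk : 0 < k) :
    Real.exp 1 < ((k : ℝ) + 3) ^ (C * (k + 1)) ∧
      C / (Real.log C + 2) * (k : ℝ) ≤ logOverLogLog (((k : ℝ) + 3) ^ (C * (k + 1))) ∧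
      logOverLogLog (((k : ℝ) + 3) ^ (C * (k + 1))) ≤ 2 * C * k := by
  have hC' : (3 : ℝ) ≤ C := by exact_mod_cast hC
  have hk' : (1 : ℝ) ≤ k := by exact_mod_cast hk
  have hl : 1 ≤ Real.log ((k : ℝ) + 3) := by
    rw [Real.le_log_iff_exp_le (by linarith)]
    linarith [Real.exp_one_lt_three]
  have hlC : 0 ≤ Real.log C := Real.log_nonneg (by linarith)
  have hlog : Real.log (((k : ℝ) + 3) ^ (C * (k + 1))) = C * (k + 1) * Real.log ((k : ℝ) + 3) := by
    rw [Real.log_pow]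
    push_cast
    rfl
  have hCk : (k : ℝ) + 3 ≤ C * (k + 1) := by nlinarith
  have hlow : Real.log ((k : ℝ) + 3) ≤ Real.log (C * (k + 1) * Real.log ((k : ℝ) + 3)) :=
    Real.log_le_log (by linarith) (hCk.trans (le_mul_of_one_le_right (by positivity) hl))
  have hup : Real.log (C * (k + 1) * Real.log ((k : ℝ) + 3))
      ≤ (Real.log C + 2) * Real.log ((k : ℝ) + 3) := by
    rw [Real.log_mul (by positivity) (by linarith), Real.log_mul (by positivity) (by positivity)]
    have h1 : Real.log ((k : ℝ) + 1) ≤ Real.log ((k : ℝ) + 3) :=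
      Real.log_le_log (by linarith) (by linarith)
    have h2 : Real.log (Real.log ((k : ℝ) + 3)) ≤ Real.log ((k : ℝ) + 3) :=
      Real.log_le_self (by linarith)
    nlinarith
  refine ⟨?_, ?_, ?_⟩
  · rw [← Real.lt_log_iff_exp_lt (by positivity), hlog]
    nlinarith
  · rw [logOverLogLog, hlog, le_div_iff₀ (by linarith)]
    calc C / (Real.log C + 2) * (k : ℝ) * Real.log (C * (k + 1) * Real.log ((k : ℝ) + 3))
        ≤ C / (Real.log C + 2) * (k : ℝ) * ((Real.log C + 2) * Real.log ((k : ℝ) + 3)) :=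
          mul_le_mul_of_nonneg_left hup (by positivity)
      _ = C * k * Real.log ((k : ℝ) + 3) := by
          have : Real.log C + 2 ≠ 0 := by linarith
          field_simp
      _ ≤ _ := mul_le_mul_of_nonneg_right (by nlinarith) (by linarith)
  · rw [logOverLogLog, hlog, div_le_iff₀ (by linarith)]
    exact mul_le_mul (by nlinarith) hlow (by linarith) (by positivity)

/-- The density of a tilted parity in exponential form. -/
theorem exists_one_add_mul_eq_exp {a : ℝ} (ha0 : 0 < a) (ha1 : a < 1) :
    ∃ J D : ℝ, 0 < J ∧ 0 < D ∧
      ∀ (N : ℕ) (S : Finset (Fin N)) x, 1 + a * spinProd S x = D * Real.exp (J * spinProd S x) := by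
  refine ⟨(Real.log (1 + a) - Real.log (1 - a)) / 2,
    Real.exp ((Real.log (1 + a) + Real.log (1 - a)) / 2), ?_, Real.exp_pos _, fun N S x => ?_⟩
  · have := Real.log_lt_log (show 0 < 1 - a by linarith) (show 1 - a < 1 + a by linarith)
    linarith
  · rw [← Real.exp_add]
    rcases spinProd_eq_or S x with h | h <;> rw [h]
    · rw [← Real.exp_log (show 0 < 1 + a * 1 by linarith)]
      ring_nf
    · rw [← Real.exp_log (show 0 < 1 + a * -1 by linarith)]
      ring_nf

/-- Tilted parities of a fixed tilt on `d` coordinates are visible laws of `(O(1) d ^ 2d, 2)`-bounded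
RBMs. -/
theorem exists_rbm_tiltedParity {a : ℝ} (ha0 : 0 < a) (ha1 : a < 1) :
    ∃ B : ℝ, ∀ {N : ℕ} (S : Finset (Fin N)) (P : PMF (Fin N → Bool)), 2 ≤ S.card →
      IsTiltedParity P S a → ∃ (m : ℕ) (R : RBM N m), R.visibleLaw = P ∧
        ∀ lam1 : ℝ, B * (S.card : ℝ) ^ (2 * S.card) ≤ lam1 → R.IsBounded lam1 2 := by
  obtain ⟨J, D, hJ, hD, h⟩ := exists_one_add_mul_eq_exp ha0 ha1
  refine ⟨4 * J * Real.exp 8 + 1, fun {N} S P hS hP => ?_⟩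
  obtain ⟨m, R, K, hK, hR, hv, hW, hm⟩ := exists_rbm_parity S hS hJ
  refine ⟨m, R, R.visibleLaw_eq P (K := K * 2 ^ N / D) (by positivity) fun x => ?_,
    fun lam1 hlam => R.isBounded_of_weights hv (hm.trans hlam) hW⟩
  rw [hR, hP x, h, one_div, inv_pow]
  field_simp

theorem exists_rbm_uniform (N : ℕ) :
    ∃ (m : ℕ) (R : RBM N m), R.visibleLaw = PMF.uniformOfFintype (Fin N → Bool) ∧
      ∀ lam1 : ℝ, 0 ≤ lam1 → R.IsBounded lam1 2 := by
  let R : RBM N 0 := { weight := 0, visBias := 0, hidBias := 0 }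
  refine ⟨0, R, R.visibleLaw_eq _ (K := 2 ^ N) (by positivity) fun x => ?_, fun lam1 h =>
    R.isBounded_of_weights (fun _ => rfl) (by simpa using h) fun j => j.elim0⟩
  rw [R.sum_exp_potential fun _ => rfl]
  simp

/-- A correct matrix contains a `true` under parity and none under the uniform law. Each failure has
probability at most `1/200`, which adds up to `1/100`. -/
theorem SampleTM.RecoversStructure.solvesSparseParity {M : SampleTM} {n k t : ℕ}
    {F : Set (Σ m : ℕ, RBM (n + 1) m)} (hM : M.RecoversStructure F n k t)
    {beta : Set.Ioo (0 : ℝ) (1 / 2)} (hk : 0 < k)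
    (hunif : ∃ R ∈ F, R.2.visibleLaw = PMF.uniformOfFintype (Fin (n + 1) → Bool))
    (hpar : ∀ S : Finset (Fin n), S.card = k → ∃ R ∈ F, R.2.visibleLaw = parityLaw beta S) :
    M.anyTrue.SolvesSparseParity beta n k t := by
  obtain ⟨R, hRF, hR⟩ := hunif
  obtain ⟨h0, h0p⟩ := hM R hRF
  rw [hR] at h0 h0p
  refine ⟨h0.anyTrue, fun S hS => ?_⟩
  obtain ⟨R', hRF', hR'⟩ := hpar S hS
  obtain ⟨h1, h1p⟩ := hM R' hRF'
  rw [hR'] at h1 h1p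
  refine ⟨h1.anyTrue, ?_⟩
  have hb1 := beta.2.1
  have hb2 := beta.2.2
  have e0 := outputProb_anyTrue_le h0 (b := false)
    (fun v hv => decide_eq_false ((isTiltedParity_uniform ∅).true_notMem_of_correct hv)) h0p
  have e1 := outputProb_anyTrue_le h1 (b := true)
    (fun v hv => decide_eq_true ((isTiltedParity_parityLaw beta S).true_mem_of_correct
      (abs_lt.mpr ⟨by linarith, by linarith⟩) (by linarith)
      (by rw [card_paritySupport]; omega) hv)) h1p
  linarith

end

theorem mainTheorem9 (beta : Set.Ioo (0 : ℝ) (1 / 2)) (hard : SparseParityHard beta) :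
    ∃ (eta : ℝ) (lam1 : ℕ → ℝ) (F : ∀ n _k : ℕ, Set (Σ m : ℕ, RBM (n + 1) m)),
      0 < eta ∧
      (∃ a : ℝ, 0 < a ∧ ∀ k : ℕ, 0 < k →
        Real.exp 1 < lam1 k / eta ∧ a * (k : ℝ) ≤ logOverLogLog (lam1 k / eta)) ∧
      (∀ n k : ℕ, 0 < k → ∀ R ∈ F n k,
        R.2.IsBounded (lam1 k) 2 ∧ AllNondegenerate R.2.visibleLaw eta) ∧
      ∀ k : ℕ → ℕ, IsSparsitySequence k →
        ∀ (M : SampleTM) (T : ℕ → ℕ),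
          (∀ᶠ n in atTop, M.RecoversStructure (F n (k n)) n (k n) (T n)) →
          ∃ c : ℝ, 0 < c ∧ ∀ᶠ n : ℕ in atTop,
            (n : ℝ) ^ (c * logOverLogLog (lam1 (k n) / eta)) ≤ (T n : ℝ) := by
  have hb1 := beta.2.1
  have hb2 := beta.2.2
  set a : ℝ := 2 * beta.1 with ha
  have ha0 : 0 < a := by linarith
  have ha1 : a < 1 := by linarith
  have habs : |a| < 1 := abs_lt.mpr ⟨by linarith, ha1⟩
  set eta := ((1 + a) * Real.log (1 + a) + (1 - a) * Real.log (1 - a)) / 2 with heta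
  have heta0 : 0 < eta := tilt_information_pos habs ha0.ne'
  obtain ⟨B, hB⟩ := exists_rbm_tiltedParity ha0 ha1
  -- The power `C'` absorbs the constant `B / eta`, and the extra 3 in `C` covers `(k + 1) ^ (2 (k +
  -- 1))`.
  obtain ⟨C', hC'⟩ := pow_unbounded_of_one_lt (B / eta) one_lt_two
  set C := C' + 3 with hC
  have hC3 : (3 : ℝ) ≤ C := by rw [hC]; push_cast; linarith [C'.cast_nonneg (α := ℝ)]
  -- The factor `eta` makes `lam1 k / eta` a pure power.
  set lam1 : ℕ → ℝ := fun k => eta * ((k : ℝ) + 3) ^ (C * (k + 1)) with hlam1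
  have hdiv : ∀ k, lam1 k / eta = ((k : ℝ) + 3) ^ (C * (k + 1)) := fun k => by
    rw [hlam1]
    exact mul_div_cancel_left₀ _ heta0.ne'
  have hBlam : ∀ k, B * ((k + 1 : ℕ) : ℝ) ^ (2 * (k + 1)) ≤ lam1 k := fun k => by
    have hk3 : (2 : ℝ) ≤ k + 3 := by linarith [k.cast_nonneg (α := ℝ)]
    have hk1 : (1 : ℝ) ≤ k + 3 := by linarith
    have hBe : B ≤ eta * ((k : ℝ) + 3) ^ (C' * (k + 1)) := by
      have h1 : (2 : ℝ) ^ C' ≤ ((k : ℝ) + 3) ^ (C' * (k + 1)) :=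
        (pow_le_pow_left₀ (by norm_num) hk3 _).trans
          (pow_le_pow_right₀ hk1 (Nat.le_mul_of_pos_right _ k.succ_pos))
      have := (div_lt_iff₀' heta0).mp hC'
      exact this.le.trans (mul_le_mul_of_nonneg_left h1 heta0.le)
    have hpow : ((k + 1 : ℕ) : ℝ) ^ (2 * (k + 1)) ≤ ((k : ℝ) + 3) ^ (3 * (k + 1)) := by
      refine (pow_le_pow_left₀ (by positivity) ?_ _).trans (pow_le_pow_right₀ hk1 (by omega))
      push_cast
      linarith
    calc B * ((k + 1 : ℕ) : ℝ) ^ (2 * (k + 1))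
        ≤ eta * ((k : ℝ) + 3) ^ (C' * (k + 1)) * ((k : ℝ) + 3) ^ (3 * (k + 1)) :=
          mul_le_mul hBe hpow (by positivity) (by positivity)
      _ = lam1 k := by rw [hlam1]; simp only [hC]; rw [mul_assoc, ← pow_add, add_mul]
  have hlam0 : ∀ k, 0 ≤ lam1 k := fun k => by rw [hlam1]; positivity
  refine ⟨eta, lam1, fun n k => {R | R.2.IsBounded (lam1 k) 2 ∧
    (R.2.visibleLaw = PMF.uniformOfFintype (Fin (n + 1) → Bool) ∨
      ∃ S : Finset (Fin n), S.card = k ∧ R.2.visibleLaw = parityLaw beta S)},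
    heta0, ⟨C / (Real.log C + 2), ?_, fun k hk => ?_⟩, ?_, ?_⟩
  · have := Real.log_nonneg (show (1 : ℝ) ≤ C by linarith)
    positivity
  · rw [hdiv]
    have := logOverLogLog_pow_bounds (C := C) (by omega) hk
    exact ⟨this.1, this.2.1⟩
  · rintro n k - R ⟨hbd, hR | ⟨S, -, hR⟩⟩
    · refine ⟨hbd, ?_⟩
      rw [hR]
      rintro i j ⟨A, hA, hj⟩
      rw [(isTiltedParity_uniform ∅).isMarkovBlanket_iff (by simp), if_pos (Or.inl rfl)] at hA
      simp [hA] at hj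
    · refine ⟨hbd, ?_⟩
      rw [hR]
      exact (isTiltedParity_parityLaw beta S).allNondegenerate habs
  · intro k hk M T hM
    obtain ⟨c, hc, hT⟩ := hard k hk M.anyTrue T (hM.mono fun n hn =>
      hn.solvesSparseParity (hk.1 n)
        (by
          obtain ⟨m, R, hR, hbd⟩ := exists_rbm_uniform (n + 1)
          exact ⟨⟨m, R⟩, ⟨hbd _ (hlam0 _), Or.inl hR⟩, hR⟩)
        (fun S hS => by
          obtain ⟨m, R, hR, hbd⟩ := hB (paritySupport S) (parityLaw beta S)
            (by rw [card_paritySupport, hS]; have := hk.1 n; omega)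
            (isTiltedParity_parityLaw beta S)
          refine ⟨⟨m, R⟩, ⟨hbd _ ?_, Or.inr ⟨S, hS, hR⟩⟩, hR⟩
          rw [card_paritySupport, hS]
          exact hBlam (k n)))
    -- The exponent in question is at most `2 * C * k n`, so this constant turns the bound `n ^ (c *
    -- k n)` into the required one.
    refine ⟨c / (2 * C), by positivity, ?_⟩
    filter_upwards [hT, eventually_ge_atTop 1] with n hn hn1
    refine le_trans (Real.rpow_le_rpow_of_exponent_le (by exact_mod_cast hn1) ?_) hn
    rw [hdiv]
    have := (logOverLogLog_pow_bounds (C := C) (by omega) (hk.1 n)).2.2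
    calc c / (2 * C) * logOverLogLog (((k n : ℝ) + 3) ^ (C * (k n + 1)))
        ≤ c / (2 * C) * (2 * C * k n) := mul_le_mul_of_nonneg_left this (by positivity)
      _ = c * k n := by field_simp
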